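/- A signature $\sigma=\sigma_{\mathcal B}\sqcup\sigma_{\mathcal D}$ is a finite set of relation symbols with arities, split into base relations ($\sigma_{\mathcal B}$) and distinguished relations ($\sigma_{\mathcal D}$), the latter being binary. The domain of a set of facts is the set of all elements occurring in its facts; formulas have no constants and are evaluated over this domain. A conjunctive query (CQ) is a sentence $\exists\vec x\,\varphi$ with $\varphi$ a conjunction of relational or equality atoms. A base-guard for a set of variables is a base atom or an equality using all these variables; a CQ is base-covered if each of its distinguished atoms has a base-guard (for the variables of the atom) in the CQ. A TGD is a sentence $\forall\vec x\,(\bigwedge_i\gamma_i(\vec x)\to\exists\vec y\,\bigwedge_i\rho_i(\vec x,\vec y))$ with non-empty conjunctions of atoms as body and head; it is a BaseFGTGD if its body contains a base-guard for the variables that occur in both body and head. An inclusion dependency is a TGD whose body and head each consist of a single relational atom without repeated variables. For a finite set $\mathcal F_0$ of facts, a finite set $\Sigma$ of constraints and a query $Q$, $\mathrm{QAlin}(\mathcal F_0,\Sigma,Q)$ holds if there is no (finite or infinite) set of facts $\mathcal F\supseteq\mathcal F_0$ that satisfies $\Sigma$, does not satisfy $Q$, and in which each distinguished relation is a strict linear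 order on the domain of $\mathcal F$. **Theorem.** There are a signature $\sigma=\sigma_{\mathcal B}\sqcup\sigma_{\mathcal D}$ where $\sigma_{\mathcal D}$ consists of a single relation, a finite set $\Sigma$ of inclusion dependencies on $\sigma_{\mathcal B}$ (so not mentioning the order), and a CQ $Q$ on $\sigma$ that is not base-covered, such that the following problem is undecidable: given a finite set of facts $\mathcal F_0$, decide $\mathrm{QAlin}(\mathcal F_0,\Sigma,Q)$. **Corollary.** There are a signature $\sigma=\sigma_{\mathcal B}\sqcup\sigma_{\mathcal D}$ where $\sigma_{\mathcal D}$ consists of a single relation, and a finite set $\Sigma'$ of BaseFGTGDs on $\sigma$, such that the following problem is undecidable: given a finite set of facts $\mathcal F_0$, decide $\mathrm{QAlin}(\mathcal F_0,\Sigma',\bot)$, where $\bot$ is the always-false query (that is, decide whether no set of facts $\mathcal F\supseteq\mathcal F_0$ satisfies $\Sigma'$ with the distinguished relation being a strict linear order on the domain of $\mathcal F$). -/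

import Mathlib

namespace OrderQA

/-- A finite relational signature, split into base relations (of arbitrary arities) and
distinguished relations (all binary). -/
structure Signature where
  numBase : ℕ
  baseArity : Fin numBase → ℕ
  numDist : ℕ

namespace Signature

/-- Relation symbols: `Sum.inl i` is a base relation, `Sum.inr j` a distinguished relation. -/
abbrev Rel (σ : Signature) : Type := Fin σ.numBase ⊕ Fin σ.numDist

def arity (σ : Signature) : σ.Rel → ℕ
  | Sum.inl i => σ.baseArity i
  | Sum.inr _ => 2

end Signature

/-- A relation symbol applied to a tuple, of the right length, of elements of `α`.
With `α` a set of elements this is a fact; with `α = ℕ` seen as a set of variables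
it is a relational atom. -/
abbrev RelAtom (σ : Signature) (α : Type) : Type :=
  {p : σ.Rel × List α // p.2.length = σ.arity p.1}

namespace RelAtom

variable {σ : Signature} {α β : Type}

def rel (f : RelAtom σ α) : σ.Rel := f.1.1

def args (f : RelAtom σ α) : List α := f.1.2

def map (g : α → β) (f : RelAtom σ α) : RelAtom σ β :=
  ⟨(f.1.1, f.1.2.map g), by rw [List.length_map]; exact f.2⟩

/-- The fact (or atom) `a <ⱼ b`. -/
def lt (j : Fin σ.numDist) (a b : α) : RelAtom σ α := ⟨(Sum.inr j, [a, b]), rfl⟩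

theorem primrecPred_wellFormed (σ : Signature) :
    PrimrecPred (fun p : σ.Rel × List ℕ => p.2.length = σ.arity p.1) :=
  Primrec.eq.comp (Primrec.list_length.comp Primrec.snd)
    ((Primrec.dom_finite σ.arity).comp Primrec.fst)

/-- The standard coding of facts whose elements are natural numbers. -/
instance instPrimcodable (σ : Signature) : Primcodable (RelAtom σ ℕ) :=
  Primcodable.subtype (primrecPred_wellFormed σ)

end RelAtom

/-- The domain of a set of facts: all elements occurring in some fact. -/
def elems {σ : Signature} {A : Type} (F : Set (RelAtom σ A)) : Set A :=
  {a | ∃ f ∈ F, a ∈ f.args}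

/-- Atomic formulas, with variables named by natural numbers, and no constants. -/
inductive Atom (σ : Signature) : Type
  | rel (f : RelAtom σ ℕ) : Atom σ
  | eq (x y : ℕ) : Atom σ

namespace Atom

variable {σ : Signature} {A : Type}

def vars : Atom σ → Set ℕ
  | rel f => {x | x ∈ f.args}
  | eq x y => {x, y}

def Holds (F : Set (RelAtom σ A)) (v : ℕ → A) : Atom σ → Prop
  | rel f => f.map v ∈ F
  | eq x y => v x = v y

/-- The atom uses a distinguished relation. -/
def IsDist : Atom σ → Prop
  | rel f => ∃ j, f.rel = Sum.inr j
  | eq _ _ => False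

/-- The atom uses a base relation. -/
def IsBase : Atom σ → Prop
  | rel f => ∃ i, f.rel = Sum.inl i
  | eq _ _ => False

def IsEq : Atom σ → Prop
  | rel _ => False
  | eq _ _ => True

/-- `a` is a base-guard for the set `X` of variables: it is an equality or an atom over a base
relation, and it uses every variable of `X`. -/
def IsBaseGuard (a : Atom σ) (X : Set ℕ) : Prop :=
  (a.IsBase ∨ a.IsEq) ∧ X ⊆ a.vars

end Atom

/-- The variables of a list of atoms. -/
def varsOf {σ : Signature} (l : List (Atom σ)) : Set ℕ := {x | ∃ a ∈ l, x ∈ a.vars}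

/-- `v` maps the variables of the conjunction `l` of atoms into the domain of `F`, and makes
all the atoms of `l` true in `F`. -/
def IsMatch {σ : Signature} {A : Type} (F : Set (RelAtom σ A)) (l : List (Atom σ))
    (v : ℕ → A) : Prop :=
  (∀ x ∈ varsOf l, v x ∈ elems F) ∧ ∀ a ∈ l, a.Holds F v

/-- A Boolean conjunctive query: the existential closure of the conjunction of its atoms. -/
structure CQ (σ : Signature) where
  atoms : List (Atom σ)

namespace CQ

variable {σ : Signature} {A : Type}

def Holds (F : Set (RelAtom σ A)) (Q : CQ σ) : Prop := ∃ v : ℕ → A, IsMatch F Q.atoms v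

/-- Every atom of `Q` over a distinguished relation has a base-guard in `Q`. -/
def BaseCovered (Q : CQ σ) : Prop :=
  ∀ a ∈ Q.atoms, a.IsDist → ∃ b ∈ Q.atoms, b.IsBaseGuard a.vars

end CQ

/-- A tuple-generating dependency. The variables of the body are universally quantified, the
variables that occur in the head only are existentially quantified. -/
structure TGD (σ : Signature) where
  body : List (Atom σ)
  head : List (Atom σ)
  body_ne : body ≠ []
  head_ne : head ≠ []

namespace TGD

variable {σ : Signature} {A : Type}

def Holds (F : Set (RelAtom σ A)) (τ : TGD σ) : Prop :=
  ∀ v : ℕ → A, IsMatch F τ.body v →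
    ∃ w : ℕ → A, (∀ x ∈ varsOf τ.body, w x = v x) ∧ IsMatch F τ.head w

/-- The frontier variables, which occur both in the body and in the head. -/
def frontier (τ : TGD σ) : Set ℕ := varsOf τ.body ∩ varsOf τ.head

/-- Inclusion dependencies: the body and the head are single relational atoms, and no variable
occurs twice in the same atom. -/
def IsID (τ : TGD σ) : Prop :=
  ∃ f g : RelAtom σ ℕ, τ.body = [Atom.rel f] ∧ τ.head = [Atom.rel g] ∧
    f.args.Nodup ∧ g.args.Nodup

/-- The dependency does not mention the distinguished relations. -/
def OnBase (τ : TGD σ) : Prop :=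
  (∀ a ∈ τ.body, ¬ a.IsDist) ∧ ∀ a ∈ τ.head, ¬ a.IsDist

/-- Base frontier-guarded: the body contains a base-guard for the frontier variables. -/
def IsBaseFGTGD (τ : TGD σ) : Prop := ∃ a ∈ τ.body, a.IsBaseGuard τ.frontier

end TGD

/-- The `j`-th distinguished relation is a strict linear order on the domain of `F`. -/
def IsStrictLinearOrderOn {σ : Signature} {A : Type} (F : Set (RelAtom σ A))
    (j : Fin σ.numDist) : Prop :=
  IsStrictTotalOrder (elems F) (fun a b => RelAtom.lt j (a : A) (b : A) ∈ F)

/-- Query answering over linear orders, for initial facts `F₀` over elements named by natural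
numbers, constraints `T`, and the union `Q` of conjunctive queries (the empty union is the
query `⊥`): there is no set `F` of facts, finite or infinite and over elements taken from an
arbitrary superset `A` of `ℕ`, that contains `F₀`, satisfies `T`, violates `Q`, and in which
each distinguished relation is a strict linear order on the elements of `F`. -/
def EntailsLin {σ : Signature} (F₀ : Set (RelAtom σ ℕ)) (T : List (TGD σ))
    (Q : List (CQ σ)) : Prop :=
  ¬ ∃ (A : Type) (ι : ℕ ↪ A) (F : Set (RelAtom σ A)),
      (∀ f ∈ F₀, f.map ι ∈ F) ∧
      (∀ τ ∈ T, τ.Holds F) ∧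
      (¬ ∃ q ∈ Q, q.Holds F) ∧
      ∀ j, IsStrictLinearOrderOn F j

end OrderQA

namespace OrderQA

variable {σ : Signature} {A : Type}

/-- The fact `r(l)` belongs to `F`. -/
def Has (F : Set (RelAtom σ A)) (r : σ.Rel) (l : List A) : Prop :=
  ∃ h, (⟨(r, l), h⟩ : RelAtom σ A) ∈ F

theorem map_mem_iff_has {F : Set (RelAtom σ A)} {B : Type} {v : B → A} {f : RelAtom σ B} :
    f.map v ∈ F ↔ Has F f.rel (f.args.map v) :=
  ⟨fun h => ⟨_, h⟩, fun ⟨_, h⟩ => h⟩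

theorem Has.mem_elems {F : Set (RelAtom σ A)} {r : σ.Rel} {l : List A} (h : Has F r l) {a : A}
    (ha : a ∈ l) : a ∈ elems F :=
  ⟨_, h.2, ha⟩

theorem isMatch_map_rel {F : Set (RelAtom σ A)} {l : List (RelAtom σ ℕ)} {v : ℕ → A} :
    IsMatch F (l.map Atom.rel) v ↔ ∀ f ∈ l, Has F f.rel (f.args.map v) := by
  constructor
  · intro h f hf
    exact map_mem_iff_has.1 (h.2 _ (List.mem_map_of_mem hf))
  · intro h
    refine ⟨?_, ?_⟩
    · rintro x ⟨a, ha, hx⟩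
      obtain ⟨f, hf, rfl⟩ := List.mem_map.1 ha
      exact (h f hf).mem_elems (List.mem_map_of_mem hx)
    · intro a ha
      obtain ⟨f, hf, rfl⟩ := List.mem_map.1 ha
      exact map_mem_iff_has.2 (h f hf)

/-- The inclusion dependency with body `f` and head `g`. -/
def inclusion (f g : RelAtom σ ℕ) : TGD σ :=
  ⟨[f].map Atom.rel, [g].map Atom.rel, by simp, by simp⟩

theorem varsOf_map_rel (l : List (RelAtom σ ℕ)) :
    varsOf (l.map Atom.rel) = {x | ∃ f ∈ l, x ∈ f.args} := by
  ext x
  constructor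
  · rintro ⟨a, ha, hx⟩
    obtain ⟨f, hf, rfl⟩ := List.mem_map.1 ha
    exact ⟨f, hf, hx⟩
  · rintro ⟨f, hf, hx⟩
    exact ⟨_, List.mem_map_of_mem hf, hx⟩

theorem inclusion_holds_iff {F : Set (RelAtom σ A)} {f g : RelAtom σ ℕ} :
    (inclusion f g).Holds F ↔ ∀ v : ℕ → A, Has F f.rel (f.args.map v) →
      ∃ w : ℕ → A, (∀ x ∈ f.args, w x = v x) ∧ Has F g.rel (g.args.map w) := by
  simp only [TGD.Holds, inclusion, isMatch_map_rel, varsOf_map_rel]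
  simp

/-- The signature used to describe algebras with `k` unary operations: `node`, `child`, `edge`,
`rule`, and the order. -/
abbrev algSig (k : ℕ) : Signature where
  numBase := 4
  baseArity := ![k + 1, k + 2, 3, 4]
  numDist := 1

section

variable (k : ℕ)

abbrev nodeRel : (algSig k).Rel := Sum.inl (0 : Fin 4)
abbrev childRel : (algSig k).Rel := Sum.inl (1 : Fin 4)
abbrev edgeRel : (algSig k).Rel := Sum.inl (2 : Fin 4)
abbrev ruleRel : (algSig k).Rel := Sum.inl (3 : Fin 4)
abbrev ltRel : (algSig k).Rel := Sum.inr (0 : Fin 1)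

variable {k}

/-- `x` is a node, and `l` lists the names of all the operations. -/
def nodeAtom {B : Type} (x : B) (l : List B) (h : l.length = k) : RelAtom (algSig k) B :=
  ⟨(nodeRel k, x :: l), by subst h; rfl⟩

/-- `y` is a value at `x` of the operation named by the first element of `l`. -/
def childAtom {B : Type} (x y : B) (l : List B) (h : l.length = k) : RelAtom (algSig k) B :=
  ⟨(childRel k, x :: y :: l), by subst h; rfl⟩

/-- `y` is a value at `x` of the operation named `f`. -/
def edgeAtom {B : Type} (x f y : B) : RelAtom (algSig k) B := ⟨(edgeRel k, [x, f, y]), rfl⟩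

/-- The identity `g (f x) = g' (f' x)` is required. -/
def ruleAtom {B : Type} (f g f' g' : B) : RelAtom (algSig k) B :=
  ⟨(ruleRel k, [f, g, f', g']), rfl⟩

variable (k)

/-- The variables that stand for the names of operations. -/
def opVars : List ℕ := (List.range k).map (· + 2)

theorem length_opVars : (opVars k).length = k := by simp [opVars]

theorem length_rotate_opVars : ((opVars k).rotate 1).length = k := by simp [opVars]

def algDeps : List (TGD (algSig k)) :=
  [inclusion (nodeAtom 0 (opVars k) (length_opVars k))
      (nodeAtom 0 ((opVars k).rotate 1) (length_rotate_opVars k)),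
   inclusion (nodeAtom 0 (opVars k) (length_opVars k))
      (childAtom 0 1 (opVars k) (length_opVars k)),
   inclusion (childAtom 0 1 (opVars k) (length_opVars k))
      (nodeAtom 1 (opVars k) (length_opVars k)),
   inclusion (childAtom 0 1 (opVars k) (length_opVars k)) (edgeAtom 0 2 1)]

def algQueryAtoms : List (RelAtom (algSig k) ℕ) :=
  [edgeAtom 0 1 5, edgeAtom 5 2 6, edgeAtom 0 3 7, edgeAtom 7 4 8, ruleAtom 1 2 3 4,
    RelAtom.lt (0 : Fin 1) 6 8]

/-- Some required identity fails, in the sense that its left-hand side is less than its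
right-hand side. -/
def algQuery : CQ (algSig k) := ⟨(algQueryAtoms k).map Atom.rel⟩

variable {k}

/-- The initial facts for the given identities and the given values of operations. The `i`-th
operation is named by `i`, and the `a`-th constant by `k + a`. -/
def algFacts (rules : List (Fin k × Fin k × Fin k × Fin k)) (edges : List (ℕ × Fin k × ℕ)) :
    List (RelAtom (algSig k) ℕ) :=
  (rules.map fun r => ruleAtom (r.1 : ℕ) r.2.1 r.2.2.1 r.2.2.2) ++
  edges.flatMap fun e =>
    [nodeAtom (k + e.1) (List.range k) List.length_range,
     nodeAtom (k + e.2.2) (List.range k) List.length_range,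
     edgeAtom (k + e.1) e.2.1 (k + e.2.2)]

/-- There is an algebra that satisfies the identities, in which distinct constants have distinct
values and the operations take the prescribed values. -/
def Solvable (rules : List (Fin k × Fin k × Fin k × Fin k)) (edges : List (ℕ × Fin k × ℕ)) :
    Prop :=
  ∃ (D : Type) (fn : Fin k → D → D) (ν : ℕ → D), Function.Injective ν ∧
    (∀ r ∈ rules, ∀ x, fn r.2.1 (fn r.1 x) = fn r.2.2.2 (fn r.2.2.1 x)) ∧
    ∀ e ∈ edges, fn e.2.1 (ν e.1) = ν e.2.2

theorem isID_of_mem_algDeps : ∀ τ ∈ algDeps k, τ.IsID ∧ τ.OnBase := by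
  have hn : (opVars k).Nodup := List.Nodup.map (fun a b h => by simpa using h) List.nodup_range
  have h0 : 0 ∉ opVars k := by simp [opVars]
  have h1 : 1 ∉ opVars k := by simp [opVars]
  have key : ∀ f g : RelAtom (algSig k) ℕ, f.args.Nodup → g.args.Nodup →
      (¬ ∃ j, f.rel = Sum.inr j) → (¬ ∃ j, g.rel = Sum.inr j) →
      (inclusion f g).IsID ∧ (inclusion f g).OnBase := by
    intro f g hf hg hf' hg'
    refine ⟨⟨f, g, rfl, rfl, hf, hg⟩, ?_, ?_⟩
    · intro a ha
      obtain rfl : a = Atom.rel f := by simpa [inclusion] using ha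
      exact hf'
    · intro a ha
      obtain rfl : a = Atom.rel g := by simpa [inclusion] using ha
      exact hg'
  simp only [algDeps, List.mem_cons, List.not_mem_nil, or_false]
  rintro τ (rfl | rfl | rfl | rfl) <;> apply key <;>
    simp [nodeAtom, childAtom, edgeAtom, RelAtom.args, RelAtom.rel, hn, h0, h1,
      List.nodup_rotate]

theorem not_baseCovered_algQuery : ¬ (algQuery k).BaseCovered := by
  intro h
  obtain ⟨b, hb, hg, hs⟩ := h (Atom.rel (RelAtom.lt (0 : Fin 1) 6 8))
    (List.mem_map_of_mem (by simp [algQueryAtoms])) ⟨_, rfl⟩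
  have h6 : 6 ∈ b.vars := hs (by simp [Atom.vars, RelAtom.lt, RelAtom.args])
  have h8 : 8 ∈ b.vars := hs (by simp [Atom.vars, RelAtom.lt, RelAtom.args])
  simp only [algQuery, algQueryAtoms, List.map_cons, List.map_nil, List.mem_cons,
    List.not_mem_nil, or_false] at hb
  rcases hb with rfl | rfl | rfl | rfl | rfl | rfl <;>
    simp [Atom.vars, RelAtom.args, edgeAtom, ruleAtom, Atom.IsBase, Atom.IsEq, RelAtom.rel,
      RelAtom.lt] at h6 h8 hg

theorem exists_valuation (x y : A) (l : List A) (hl : l.length = k) :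
    ∃ v : ℕ → A, v 0 = x ∧ v 1 = y ∧ (opVars k).map v = l := by
  refine ⟨fun n => match n with
    | 0 => x
    | 1 => y
    | n + 2 => l.getD n x, rfl, rfl, ?_⟩
  apply List.ext_getElem
  · simp [opVars, hl]
  · intro i h1 h2
    simp [opVars, h2]

end
end OrderQA

namespace OrderQA

variable {A : Type} {k : ℕ}

theorem algDeps_hold_iff (hk : 0 < k) {F : Set (RelAtom (algSig k) A)} :
    (∀ τ ∈ algDeps k, τ.Holds F) ↔ ∀ (x : A) (l : List A), l.length = k →
      (Has F (nodeRel k) (x :: l) →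
        Has F (nodeRel k) (x :: l.rotate 1) ∧ ∃ y, Has F (childRel k) (x :: y :: l)) ∧
      ∀ y, Has F (childRel k) (x :: y :: l) →
        Has F (nodeRel k) (y :: l) ∧ ∀ f ∈ l.head?, Has F (edgeRel k) [x, f, y] := by
  have hk' : opVars k ≠ [] := by
    intro h; have := length_opVars k; rw [h] at this; simp at this; omega
  have h2 : (opVars k).head? = some 2 := by
    obtain ⟨m, rfl⟩ := Nat.exists_eq_succ_of_ne_zero hk.ne'
    simp [opVars, List.range_succ_eq_map]
  have h1 : ∀ n ∈ opVars k, n ≠ 1 := by simp [opVars]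
  simp only [algDeps, List.mem_cons, List.not_mem_nil, or_false, forall_eq_or_imp, forall_eq,
    inclusion_holds_iff]
  simp only [nodeAtom, childAtom, edgeAtom, RelAtom.rel, RelAtom.args, List.map_cons,
    List.map_nil, List.map_rotate, List.mem_cons]
  constructor
  · rintro ⟨ha, hb, hc, hd⟩ x l hl
    refine ⟨fun h => ?_, fun y h => ?_⟩
    · obtain ⟨v, rfl, -, rfl⟩ := exists_valuation x x l hl
      obtain ⟨w, hw, hh⟩ := ha v h
      obtain ⟨u, hu, hh'⟩ := hb v h
      rw [hw 0 (.inl rfl), List.map_congr_left fun n hn => hw n (.inr hn)] at hh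
      rw [hu 0 (.inl rfl), List.map_congr_left fun n hn => hu n (.inr hn)] at hh'
      exact ⟨hh, _, hh'⟩
    · obtain ⟨v, rfl, rfl, rfl⟩ := exists_valuation x y l hl
      obtain ⟨w, hw, hh⟩ := hc v h
      obtain ⟨u, hu, hh'⟩ := hd v h
      rw [hw 1 (.inr (.inl rfl)), List.map_congr_left fun n hn => hw n (.inr (.inr hn))] at hh
      rw [hu 0 (.inl rfl), hu 1 (.inr (.inl rfl)),
        hu 2 (.inr (.inr (List.mem_of_head? h2)))] at hh'
      refine ⟨hh, fun f hf => ?_⟩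
      rw [List.head?_map, h2] at hf
      cases hf
      exact hh'
  · intro h
    refine ⟨fun v hv => ⟨v, fun _ _ => rfl, ((h _ _ (by simp [opVars])).1 hv).1⟩, ?_,
      fun v hv => ⟨v, fun _ _ => rfl, ((h _ _ (by simp [opVars])).2 _ hv).1⟩,
      fun v hv => ⟨v, fun _ _ => rfl, ((h _ _ (by simp [opVars])).2 _ hv).2 _
        (by rw [List.head?_map, h2]; rfl)⟩⟩
    intro v hv
    obtain ⟨y, hy⟩ := ((h _ _ (by simp [opVars])).1 hv).2
    have hne : ∀ n ∈ opVars k, Function.update v 1 y n = v n :=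
      fun n hn => Function.update_of_ne (h1 n hn) _ _
    refine ⟨Function.update v 1 y, ?_, ?_⟩
    · rintro n (rfl | hn)
      · simp
      · exact hne n hn
    · rw [List.map_congr_left hne]
      simpa using hy

theorem algQuery_holds_iff {F : Set (RelAtom (algSig k) A)} :
    (algQuery k).Holds F ↔ ∃ x f g f' g' a y b z : A,
      Has F (edgeRel k) [x, f, a] ∧ Has F (edgeRel k) [a, g, y] ∧ Has F (edgeRel k) [x, f', b] ∧
      Has F (edgeRel k) [b, g', z] ∧ Has F (ruleRel k) [f, g, f', g'] ∧
      Has F (ltRel k) [y, z] := by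
  simp only [CQ.Holds, algQuery, isMatch_map_rel]
  simp only [algQueryAtoms, edgeAtom, ruleAtom, RelAtom.lt, RelAtom.rel, RelAtom.args,
    List.mem_cons, List.not_mem_nil, or_false, forall_eq_or_imp, forall_eq, List.map_cons,
    List.map_nil]
  constructor
  · rintro ⟨v, h⟩
    exact ⟨v 0, v 1, v 2, v 3, v 4, v 5, v 6, v 7, v 8, h⟩
  · rintro ⟨x, f, g, f', g', a, y, b, z, h⟩
    exact ⟨fun n => match n with
      | 0 => x | 1 => f | 2 => g | 3 => f' | 4 => g' | 5 => a | 6 => y | 7 => b | _ => z, h⟩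

theorem algFacts_subset_iff {F : Set (RelAtom (algSig k) A)} {ι : ℕ → A}
    {rules : List (Fin k × Fin k × Fin k × Fin k)} {edges : List (ℕ × Fin k × ℕ)} :
    (∀ f ∈ {f | f ∈ algFacts rules edges}, f.map ι ∈ F) ↔
      (∀ f g f' g', (f, g, f', g') ∈ rules → Has F (ruleRel k) [ι f, ι g, ι f', ι g']) ∧
      ∀ a i b, (a, i, b) ∈ edges → Has F (nodeRel k) (ι (k + a) :: (List.range k).map ι) ∧
        Has F (nodeRel k) (ι (k + b) :: (List.range k).map ι) ∧
        Has F (edgeRel k) [ι (k + a), ι i, ι (k + b)] := by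
  simp only [map_mem_iff_has, Set.mem_ofPred_eq, algFacts, List.mem_append, or_imp, forall_and]
  refine and_congr ?_ ?_
  · constructor
    · intro h f g f' g' hr
      exact h _ (List.mem_map_of_mem hr)
    · intro h f hf
      obtain ⟨r, hr, rfl⟩ := List.mem_map.1 hf
      exact h _ _ _ _ hr
  · constructor
    · intro h
      have h' := fun e he f hf => h f (List.mem_flatMap.2 ⟨e, he, hf⟩)
      refine ⟨?_, ?_, ?_⟩ <;> intro a i b he
      · exact h' _ he _ (List.mem_cons_self)
      · exact h' _ he _ (List.mem_cons_of_mem _ List.mem_cons_self)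
      · exact h' _ he _ (List.mem_cons_of_mem _ (List.mem_cons_of_mem _ List.mem_cons_self))
    · rintro ⟨h1, h2, h3⟩ f hf
      obtain ⟨⟨a, i, b⟩, he, hf⟩ := List.mem_flatMap.1 hf
      simp only [List.mem_cons, List.not_mem_nil, or_false] at hf
      rcases hf with rfl | rfl | rfl
      · exact h1 _ _ _ he
      · exact h2 _ _ _ he
      · exact h3 _ _ _ he

section Extraction

variable {F : Set (RelAtom (algSig k) A)}

theorem has_node_rotate {x : A} {l : List A}
    (hr : ∀ l : List A, l.length = k → Has F (nodeRel k) (x :: l) →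
      Has F (nodeRel k) (x :: l.rotate 1)) (hl : l.length = k)
    (h : Has F (nodeRel k) (x :: l)) (n : ℕ) : Has F (nodeRel k) (x :: l.rotate n) := by
  induction n with
  | zero => simpa using h
  | succ n ih =>
    rw [← List.rotate_rotate]
    exact hr _ (by simpa using hl) ih

theorem exists_edge (hT : ∀ τ ∈ algDeps k, τ.Holds F) {x : A} {l : List A} (hl : l.length = k)
    (h : Has F (nodeRel k) (x :: l)) (i : ℕ) (hi : i < l.length) :
    ∃ y, Has F (nodeRel k) (y :: l) ∧ Has F (edgeRel k) [x, l[i], y] := by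
  have H := (algDeps_hold_iff (by omega)).1 hT
  have hr : ∀ x l, l.length = k → Has F (nodeRel k) (x :: l) →
      Has F (nodeRel k) (x :: l.rotate 1) := fun x l hl h => ((H x l hl).1 h).1
  have hl' : (l.rotate i).length = k := by simpa using hl
  obtain ⟨y, hy⟩ := ((H _ _ hl').1 (has_node_rotate (hr x) hl h i)).2
  obtain ⟨hy1, hy2⟩ := (H _ _ hl').2 y hy
  refine ⟨y, ?_, hy2 _ ?_⟩
  · have := has_node_rotate (hr y) hl' hy1 (l.length - i)
    rwa [List.rotate_rotate, Nat.add_sub_cancel' hi.le, List.rotate_length] at this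
  · rw [List.head?_rotate hi, List.getElem?_eq_getElem hi]; rfl

open Classical in
theorem solvable_of_not_entailsLin {rules : List (Fin k × Fin k × Fin k × Fin k)}
    {edges : List (ℕ × Fin k × ℕ)}
    (hsymm : ∀ f g f' g', (f, g, f', g') ∈ rules → (f', g', f, g) ∈ rules)
    (hfun : ∀ a i b b', (a, i, b) ∈ edges → (a, i, b') ∈ edges → b = b')
    (h : ¬ EntailsLin {f | f ∈ algFacts rules edges} (algDeps k) [algQuery k]) :
    Solvable rules edges := by
  obtain ⟨A, ι, F, hF, hT, hQ, hlt⟩ := not_not.1 h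
  obtain ⟨hrule, hedge⟩ := algFacts_subset_iff.1 hF
  set names := (List.range k).map ι with hnames
  have hlen : names.length = k := by simp [hnames]
  have hex : ∀ (i : Fin k) (x : A), ∃ y,
      (Has F (nodeRel k) (x :: names) →
        Has F (nodeRel k) (y :: names) ∧ Has F (edgeRel k) [x, ι i, y]) ∧
      (¬ Has F (nodeRel k) (x :: names) → y = x) ∧
      ∀ a b, (a, i, b) ∈ edges → x = ι (k + a) → y = ι (k + b) := by
    intro i x
    by_cases he : ∃ a b, (a, i, b) ∈ edges ∧ x = ι (k + a)
    · obtain ⟨a, b, he, rfl⟩ := he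
      refine ⟨ι (k + b), fun _ => (hedge _ _ _ he).2, fun h => (h (hedge _ _ _ he).1).elim, ?_⟩
      intro a' b' he' haa
      obtain rfl : a = a' := by simpa using ι.injective haa
      rw [hfun _ _ _ _ he he']
    · by_cases hx : Has F (nodeRel k) (x :: names)
      · obtain ⟨y, hy1, hy2⟩ := exists_edge hT hlen hx i (by rw [hlen]; exact i.2)
        refine ⟨y, fun _ => ⟨hy1, by simpa [hnames] using hy2⟩, fun h => (h hx).elim, ?_⟩
        exact fun a b hab hxa => (he ⟨a, b, hab, hxa⟩).elim
      · exact ⟨x, fun h => (hx h).elim, fun _ => rfl,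
          fun a b hab hxa => (he ⟨a, b, hab, hxa⟩).elim⟩
  choose fn hfn1 hfn2 hfn3 using hex
  refine ⟨A, fn, fun a => ι (k + a), fun a b h => by simpa using ι.injective h, ?_,
    fun e he => hfn3 _ _ _ _ he rfl⟩
  rintro ⟨f, g, f', g'⟩ hr x
  dsimp only
  by_cases hx : Has F (nodeRel k) (x :: names)
  · obtain ⟨ha, hxa⟩ := hfn1 f x hx
    obtain ⟨hy, hay⟩ := hfn1 g _ ha
    obtain ⟨hb, hxb⟩ := hfn1 f' x hx
    obtain ⟨hz, hbz⟩ := hfn1 g' _ hb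
    have hno : ∀ f g f' g' a y b z, (f, g, f', g') ∈ rules → Has F (edgeRel k) [x, ι f, a] →
        Has F (edgeRel k) [a, ι g, y] → Has F (edgeRel k) [x, ι f', b] →
        Has F (edgeRel k) [b, ι g', z] → ¬ RelAtom.lt (0 : Fin 1) y z ∈ F := by
      intro f g f' g' a y b z hr h1 h2 h3 h4 h5
      exact hQ ⟨_, List.mem_singleton_self _, algQuery_holds_iff.2
        ⟨x, _, _, _, _, a, y, b, z, h1, h2, h3, h4, hrule _ _ _ _ hr, _, h5⟩⟩
    have := hlt 0
    have htri := this.toTrichotomous.trichotomous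
      ⟨_, hy.mem_elems List.mem_cons_self⟩ ⟨_, hz.mem_elems List.mem_cons_self⟩
      (hno _ _ _ _ _ _ _ _ hr hxa hay hxb hbz)
      (hno _ _ _ _ _ _ _ _ (hsymm _ _ _ _ hr) hxb hbz hxa hay)
    exact congrArg Subtype.val htri
  · simp only [hfn2 _ _ hx]

end Extraction
end OrderQA

namespace OrderQA

section Model

variable {k : ℕ} {D : Type} (fn : Fin k → D → D) (rules : List (Fin k × Fin k × Fin k × Fin k))
  (lt : D ⊕ Fin k → D ⊕ Fin k → Prop)

def opNames (D : Type) (k : ℕ) : List (D ⊕ Fin k) := (List.finRange k).map Sum.inr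

theorem length_opNames : (opNames D k).length = k := by simp [opNames]

theorem exists_head?_rotate_opNames (hk : 0 < k) (n : ℕ) :
    ∃ i, ((opNames D k).rotate n).head? = some (Sum.inr i) := by
  have hne : (opNames D k).rotate n ≠ [] := by
    intro h
    have := congrArg List.length h
    rw [List.length_rotate, length_opNames, List.length_nil] at this
    omega
  obtain ⟨a, ha⟩ := Option.ne_none_iff_exists'.1 (fun h => hne (List.head?_eq_none_iff.1 h))
  have := List.mem_rotate.1 (List.mem_of_head? ha)
  obtain ⟨i, -, rfl⟩ := List.mem_map.1 this
  exact ⟨i, ha⟩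

/-- The tuples of the base relations, in the structure that represents an algebra. -/
def algBase : Fin 4 → List (D ⊕ Fin k) → Prop :=
  ![fun l => ∃ x n, l = Sum.inl x :: (opNames D k).rotate n,
    fun l => ∃ x i n, ((opNames D k).rotate n).head? = some (Sum.inr i) ∧
      l = Sum.inl x :: Sum.inl (fn i x) :: (opNames D k).rotate n,
    fun l => ∃ x i, l = [Sum.inl x, Sum.inr i, Sum.inl (fn i x)],
    fun l => ∃ f g f' g', (f, g, f', g') ∈ rules ∧
      l = [Sum.inr f, Sum.inr g, Sum.inr f', Sum.inr g']]

/-- The structure that represents an algebra, with a given order. -/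
def algModel : Set (RelAtom (algSig k) (D ⊕ Fin k)) :=
  {f | match f.rel with
    | Sum.inl i => algBase fn rules i f.args
    | Sum.inr _ => ∃ a b, lt a b ∧ f.args = [a, b]}

variable {fn rules lt}

theorem has_node_algModel {l : List (D ⊕ Fin k)} :
    Has (algModel fn rules lt) (nodeRel k) l ↔ ∃ x n, l = Sum.inl x :: (opNames D k).rotate n := by
  refine ⟨fun h => h.2, fun h => ⟨?_, h⟩⟩
  obtain ⟨x, n, rfl⟩ := h
  simp [length_opNames, Signature.arity]

theorem has_child_algModel {l : List (D ⊕ Fin k)} :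
    Has (algModel fn rules lt) (childRel k) l ↔
      ∃ x i n, ((opNames D k).rotate n).head? = some (Sum.inr i) ∧
      l = Sum.inl x :: Sum.inl (fn i x) :: (opNames D k).rotate n := by
  refine ⟨fun h => h.2, fun h => ⟨?_, h⟩⟩
  obtain ⟨x, i, n, -, rfl⟩ := h
  simp [length_opNames, Signature.arity]

theorem has_edge_algModel {l : List (D ⊕ Fin k)} :
    Has (algModel fn rules lt) (edgeRel k) l ↔
      ∃ x i, l = [Sum.inl x, Sum.inr i, Sum.inl (fn i x)] := by
  refine ⟨fun h => h.2, fun h => ⟨?_, h⟩⟩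
  obtain ⟨x, i, rfl⟩ := h
  rfl

theorem has_rule_algModel {l : List (D ⊕ Fin k)} :
    Has (algModel fn rules lt) (ruleRel k) l ↔ ∃ f g f' g', (f, g, f', g') ∈ rules ∧
      l = [Sum.inr f, Sum.inr g, Sum.inr f', Sum.inr g'] := by
  refine ⟨fun h => h.2, fun h => ⟨?_, h⟩⟩
  obtain ⟨f, g, f', g', -, rfl⟩ := h
  rfl

theorem lt_mem_algModel {a b : D ⊕ Fin k} :
    RelAtom.lt (0 : Fin 1) a b ∈ algModel fn rules lt ↔ lt a b := by
  constructor
  · rintro ⟨a', b', h, h'⟩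
    simp only [RelAtom.lt, RelAtom.args, List.cons.injEq, and_true] at h'
    obtain ⟨rfl, rfl⟩ := h'
    exact h
  · exact fun h => ⟨a, b, h, rfl⟩

theorem algDeps_hold_algModel (hk : 0 < k) : ∀ τ ∈ algDeps k, τ.Holds (algModel fn rules lt) := by
  rw [algDeps_hold_iff hk]
  simp only [has_node_algModel, has_child_algModel, has_edge_algModel]
  refine fun x l hl => ⟨?_, ?_⟩
  · rintro ⟨x, n, h⟩
    obtain ⟨rfl, rfl⟩ := List.cons.inj h
    obtain ⟨i, hi⟩ := exists_head?_rotate_opNames (D := D) hk n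
    exact ⟨⟨x, n + 1, by rw [List.rotate_rotate]⟩, _, x, i, n, hi, rfl⟩
  · rintro y ⟨x, i, n, hi, h⟩
    simp only [List.cons.injEq] at h
    obtain ⟨rfl, rfl, rfl⟩ := h
    refine ⟨⟨_, n, rfl⟩, fun f hf => ?_⟩
    rw [hi] at hf
    cases hf
    exact ⟨x, i, rfl⟩

theorem exists_embedding {ν : ℕ → D} (hν : Function.Injective ν) :
    ∃ ι : ℕ ↪ D ⊕ Fin k, (∀ i : Fin k, ι i = Sum.inr i) ∧ ∀ a, ι (k + a) = Sum.inl (ν a) := by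
  let f : ℕ → D ⊕ Fin k := fun n => if h : n < k then Sum.inr ⟨n, h⟩ else Sum.inl (ν (n - k))
  have hf : Function.Injective f := by
    intro m n hmn
    dsimp only [f] at hmn
    split_ifs at hmn with h1 h2 h2
    · simpa using hmn
    · have := hν (Sum.inl.inj hmn)
      omega
  exact ⟨⟨f, hf⟩, fun i => dif_pos i.2, fun a => by simp [f]⟩

theorem not_entailsLin_of_solvable (hk : 0 < k) {edges : List (ℕ × Fin k × ℕ)}
    (h : Solvable rules edges) :
    ¬ EntailsLin {f | f ∈ algFacts rules edges} (algDeps k) [algQuery k] := by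
  obtain ⟨D, fn, ν, hν, hrules, hedges⟩ := h
  obtain ⟨ι, hι₁, hι₂⟩ := exists_embedding (k := k) hν
  refine not_not.2 ⟨D ⊕ Fin k, ι, algModel fn rules WellOrderingRel, ?_,
    algDeps_hold_algModel hk, ?_, ?_⟩
  · have hnames : (List.range k).map ι = opNames D k := by
      apply List.ext_getElem
      · simp [opNames]
      · intro i h1 h2
        have hi : i < k := by simpa using h1
        simpa [opNames] using hι₁ ⟨i, hi⟩
    refine algFacts_subset_iff.2 ⟨fun f g f' g' hr => ?_, fun a i b he => ?_⟩
    · exact has_rule_algModel.2 ⟨f, g, f', g', hr, by simp only [hι₁]⟩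
    · simp only [hnames, hι₁, hι₂]
      refine ⟨has_node_algModel.2 ⟨ν a, 0, by simp⟩, has_node_algModel.2 ⟨ν b, 0, by simp⟩,
        has_edge_algModel.2 ⟨ν a, i, ?_⟩⟩
      rw [hedges _ he]
  · rintro ⟨q, hq, hh⟩
    obtain rfl := List.mem_singleton.1 hq
    obtain ⟨x, f, g, f', g', a, y, b, z, h1, h2, h3, h4, h5, _, h6⟩ := algQuery_holds_iff.1 hh
    rw [has_edge_algModel] at h1 h2 h3 h4
    obtain ⟨x, f, h1⟩ := h1
    obtain ⟨_, g, h2⟩ := h2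
    obtain ⟨_, f', h3⟩ := h3
    obtain ⟨_, g', h4⟩ := h4
    obtain ⟨_, _, _, _, hr, h5⟩ := has_rule_algModel.1 h5
    simp only [List.cons.injEq, and_true] at h1 h2 h3 h4 h5
    obtain ⟨rfl, rfl, rfl⟩ := h1
    obtain ⟨h2, rfl, rfl⟩ := h2
    obtain ⟨h3, rfl, rfl⟩ := h3
    obtain ⟨h4, rfl, rfl⟩ := h4
    obtain rfl := Sum.inl.inj h2
    obtain rfl := Sum.inl.inj h3
    obtain rfl := Sum.inl.inj h4
    simp only [Sum.inr.injEq] at h5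
    obtain ⟨rfl, rfl, rfl, rfl⟩ := h5
    have h6 := lt_mem_algModel.1 h6
    have hr' := hrules _ hr x
    dsimp only at hr'
    rw [hr'] at h6
    exact irrefl _ h6
  · intro j
    obtain rfl : j = (0 : Fin 1) := Subsingleton.elim (α := Fin 1) _ _
    have hlt : ∀ a b, RelAtom.lt (0 : Fin 1) a b ∈ algModel fn rules WellOrderingRel ↔
        WellOrderingRel a b := fun a b => lt_mem_algModel
    refine { trichotomous := ?_, irrefl := ?_, trans := ?_ }
    · intro a b h1 h2
      rw [hlt] at h1 h2
      exact Subtype.ext (Std.Trichotomous.trichotomous _ _ h1 h2)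
    · intro a h
      exact irrefl _ ((hlt _ _).1 h)
    · intro a b c h1 h2
      rw [hlt] at *
      exact trans_of _ h1 h2

theorem not_entailsLin_iff_solvable (hk : 0 < k) {edges : List (ℕ × Fin k × ℕ)}
    (hsymm : ∀ f g f' g', (f, g, f', g') ∈ rules → (f', g', f, g) ∈ rules)
    (hfun : ∀ a i b b', (a, i, b) ∈ edges → (a, i, b') ∈ edges → b = b') :
    ¬ EntailsLin {f | f ∈ algFacts rules edges} (algDeps k) [algQuery k] ↔
      Solvable rules edges :=
  ⟨solvable_of_not_entailsLin hsymm hfun, not_entailsLin_of_solvable hk⟩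

end Model

/-- The dependency that is violated by all orders in which the query holds. -/
def algDenial (k : ℕ) : TGD (algSig k) :=
  ⟨(algQueryAtoms k).map Atom.rel, [RelAtom.lt (0 : Fin 1) 9 9].map Atom.rel,
    by simp [algQueryAtoms], by simp⟩

theorem isBaseFGTGD_algDenial {k : ℕ} : (algDenial k).IsBaseFGTGD := by
  refine ⟨Atom.rel (edgeAtom 0 1 5), List.mem_map_of_mem (by simp [algQueryAtoms]),
    .inl ⟨_, rfl⟩, ?_⟩
  rintro x ⟨hx, hx'⟩
  rw [algDenial, varsOf_map_rel] at hx hx'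
  simp [algQueryAtoms, edgeAtom, ruleAtom, RelAtom.args, RelAtom.lt] at hx hx'
  omega

theorem isBaseFGTGD_of_isID {σ : Signature} {τ : TGD σ} (h : τ.IsID) (h' : τ.OnBase) :
    τ.IsBaseFGTGD := by
  obtain ⟨f, g, hf, hg, -, -⟩ := h
  have hm : Atom.rel f ∈ τ.body := by simp [hf]
  refine ⟨_, hm, .inl ?_, ?_⟩
  · have := h'.1 _ hm
    rcases hr : f.rel with i | j
    · exact ⟨i, hr⟩
    · exact (this ⟨j, hr⟩).elim
  · rintro x ⟨hx, -⟩
    simpa [varsOf, hf] using hx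

theorem entailsLin_algDenial_iff {k : ℕ} {F₀ : Set (RelAtom (algSig k) ℕ)}
    {T : List (TGD (algSig k))} :
    EntailsLin F₀ (algDenial k :: T) [] ↔ EntailsLin F₀ T [algQuery k] := by
  refine not_congr (exists_congr fun A => exists_congr fun ι => exists_congr fun F =>
    and_congr_right fun _ => ?_)
  simp only [List.mem_cons, forall_eq_or_imp, List.not_mem_nil, false_and, exists_false,
    not_false_eq_true, true_and, or_false, exists_eq_left]
  constructor
  · rintro ⟨⟨h1, h2⟩, h3⟩
    refine ⟨h2, ?_, h3⟩
    rintro ⟨v, hv⟩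
    obtain ⟨w, -, hw⟩ := h1 v hv
    have hw9 := isMatch_map_rel.1 hw _ List.mem_cons_self
    have hmem : w 9 ∈ elems F := hw9.mem_elems (List.mem_map_of_mem List.mem_cons_self)
    exact (h3 0).toIsStrictOrder.toIrrefl.irrefl ⟨_, hmem⟩ hw9.2
  · rintro ⟨h1, h2, h3⟩
    exact ⟨⟨fun v hv => (h2 ⟨v, hv⟩).elim, h1⟩, h3⟩

end OrderQA

namespace OrderQA

open Turing

theorem trNat_two_pow (m : ℕ) : PartrecToTM2.trNat (2 ^ m) =
    List.replicate m PartrecToTM2.Γ'.bit0 ++ [PartrecToTM2.Γ'.bit1] := by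
  have key : ∀ m : ℕ, ∃ p : PosNum, ((2 ^ m : ℕ) : Num) = Num.pos p ∧
      PartrecToTM2.trPosNum p =
        List.replicate m PartrecToTM2.Γ'.bit0 ++ [PartrecToTM2.Γ'.bit1] := by
    intro m
    induction m with
    | zero => exact ⟨PosNum.one, by simp; rfl, rfl⟩
    | succ m ih =>
      obtain ⟨p, hp, hp'⟩ := ih
      refine ⟨PosNum.bit0 p, ?_, ?_⟩
      · rw [pow_succ, mul_two, Nat.cast_add, hp]
        have := Num.bit0_of_bit0 (Num.pos p)
        rw [this]; rfl
      · rw [PartrecToTM2.trPosNum, hp']; rfl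
  obtain ⟨p, hp, hp'⟩ := key m
  rw [PartrecToTM2.trNat, hp, PartrecToTM2.trNum, hp']

theorem exists_primrec_log : ∃ lg : ℕ → ℕ, Primrec lg ∧ ∀ m, lg (2 ^ m) = m := by
  refine ⟨fun n => Nat.findGreatest (fun m => 2 ^ m ≤ n) n, ?_, fun m => ?_⟩
  · refine Primrec.nat_findGreatest Primrec.id ?_
    refine Primrec.nat_le.comp ?_ Primrec.fst
    exact (Primrec₂.unpaired'.1 Nat.Primrec.pow).comp (Primrec.const 2) Primrec.snd
  · rw [Nat.findGreatest_eq_iff]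
    refine ⟨Nat.lt_two_pow_self.le, fun _ => le_rfl, fun n hn _ hle => ?_⟩
    exact absurd ((Nat.pow_le_pow_iff_right (by norm_num)).1 hle) (by omega)

theorem exists_toPartrecCode : ∃ c : ToPartrec.Code,
    ¬ ComputablePred fun m : ℕ => (c.eval [2 ^ m]).Dom := by
  obtain ⟨lg, hlg, hlg'⟩ := exists_primrec_log
  have hg : Partrec fun n : ℕ =>
      Nat.Partrec.Code.eval (Denumerable.ofNat Nat.Partrec.Code (lg n)) 0 :=
    Nat.Partrec.Code.eval_part.comp ((Computable.ofNat _).comp hlg.to_comp) (Computable.const 0)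
  obtain ⟨c, hc⟩ := ToPartrec.Code.exists_code (Nat.Partrec'.part_iff₁.2 hg)
  refine ⟨c, fun h => ComputablePred.halting_problem 0 ?_⟩
  refine ComputablePred.computable_of_manyOneReducible ⟨Encodable.encode, Computable.encode, ?_⟩ h
  intro d
  have := hc ⟨[2 ^ Encodable.encode d], rfl⟩
  simp only [List.Vector.head, hlg', Denumerable.ofNat_encode] at this
  exact iff_of_eq (congrArg Part.Dom this).symm

theorem exists_machine : ∃ (Γ Λ : Type) (_ : Inhabited Γ) (_ : Inhabited Λ) (_ : Finite Γ)
    (M : TM0.Machine Γ Λ) (S : Set Λ) (a b c : Γ), S.Finite ∧ TM0.Supports M S ∧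
    b ≠ default ∧ c ≠ default ∧ c ≠ b ∧ ¬ ComputablePred fun m : ℕ =>
      (StateTransition.eval (TM0.step M)
        ⟨default, ⟨a, ∅, ListBlank.mk (c :: List.replicate m b)⟩⟩).Dom := by
  obtain ⟨code, hcode⟩ := exists_toPartrecCode
  let _ : Inhabited PartrecToTM2.Λ' :=
    ⟨PartrecToTM2.trNormal code PartrecToTM2.Cont'.halt⟩
  let M₂ : PartrecToTM2.Λ' → TM2.Stmt (fun _ : PartrecToTM2.K' => PartrecToTM2.Γ') PartrecToTM2.Λ'
    (Option PartrecToTM2.Γ') := PartrecToTM2.tr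
  let cell : PartrecToTM2.Γ' → TM2to1.Γ' PartrecToTM2.K' (fun _ => PartrecToTM2.Γ') := fun s =>
    (false, Function.update (fun _ => none) PartrecToTM2.K'.main (some s))
  have hcell : ∀ s t, cell s = cell t → s = t := by
    intro s t h
    have := congrFun (congrArg Prod.snd h) PartrecToTM2.K'.main
    simpa [cell] using this
  have hcell' : ∀ s, cell s ≠ default := by
    intro s h
    have := congrFun (congrArg Prod.snd h) PartrecToTM2.K'.main
    simp [cell] at this
  have : Finite PartrecToTM2.K' := by
    refine Finite.of_injective (β := Fin 4) (fun k => match k with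
      | .main => 0 | .rev => 1 | .aux => 2 | .stack => 3) ?_
    intro a b h
    cases a <;> cases b <;> first | rfl | exact absurd h (by decide)
  have : Finite (TM2to1.Γ' PartrecToTM2.K' (fun _ => PartrecToTM2.Γ')) :=
    inferInstanceAs (Finite (Bool × (PartrecToTM2.K' → Option PartrecToTM2.Γ')))
  refine ⟨_, _, inferInstance, inferInstance, inferInstance, TM1to0.tr (TM2to1.tr M₂), _,
    (true, (cell .cons).2), cell .bit0, cell .bit1, Finset.finite_toSet _,
    TM1to0.tr_supports _ (TM2to1.tr_supports M₂ (PartrecToTM2.tr_supports code .halt)),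
    hcell' _, hcell' _, fun h => ?_, fun h => hcode (h.of_eq fun m => ?_)⟩
  · cases hcell _ _ h
  · have h1 : TM2to1.trInit PartrecToTM2.K'.main (PartrecToTM2.trList [2 ^ m]) =
        (true, (cell .cons).2) :: cell .bit1 :: List.replicate m (cell .bit0) := by
      have hl : (PartrecToTM2.trList [2 ^ m]).reverse =
          .cons :: .bit1 :: List.replicate m .bit0 := by
        simp [PartrecToTM2.trList, trNat_two_pow]
      rw [TM2to1.trInit, hl]
      change _ :: _ :: List.map cell _ = _
      rw [List.map_replicate]
      rfl
    have h2 := TM2to1.tr_eval_dom M₂ PartrecToTM2.K'.main (PartrecToTM2.trList [2 ^ m])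
    rw [← TM1to0.tr_eval, h1] at h2
    have h3 : (TM2.init PartrecToTM2.K'.main (PartrecToTM2.trList [2 ^ m]) :
        TM2.Cfg _ PartrecToTM2.Λ' _) = PartrecToTM2.init code [2 ^ m] := by
      rw [TM2.init, PartrecToTM2.init]
      congr 1
      funext k
      cases k <;> simp [PartrecToTM2.K'.elim]
    have h4 := congrArg Part.Dom (PartrecToTM2.tr_eval code [2 ^ m])
    rw [← h3] at h4
    exact h2.trans (iff_of_eq h4)

end OrderQA

namespace OrderQA

open Turing

section Encoding

variable {Γ Λ : Type} [Inhabited Γ] [Inhabited Λ]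

/-- The machine halts when started in the given configuration. -/
def Halts (M : TM0.Machine Γ Λ) (c : TM0.Cfg Γ Λ) : Prop :=
  (StateTransition.eval (TM0.step M) c).Dom

theorem halts_of_step_eq_none {M : TM0.Machine Γ Λ} {c : TM0.Cfg Γ Λ} (h : TM0.step M c = none) :
    Halts M c :=
  Part.dom_iff_mem.2 ⟨c, StateTransition.mem_eval.2 ⟨Relation.ReflTransGen.refl, h⟩⟩

theorem halts_iff_of_mem_step {M : TM0.Machine Γ Λ} {c c' : TM0.Cfg Γ Λ}
    (h : c' ∈ TM0.step M c) : Halts M c ↔ Halts M c' := by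
  rw [Halts, StateTransition.reaches_eval (Relation.ReflTransGen.single h), Halts]

/-- The unary operations used to describe the runs of a machine: pushing a symbol on the left or
right half of the tape, forming a configuration from a state, a scanned symbol and a tape, and two
projections that tell apart the results of halting and non-halting runs. -/
inductive Op (Γ : Type) (S : Type)
  | left (x : Γ)
  | right (x : Γ)
  | state (q : S) (x : Γ)
  | fst
  | snd

instance {S : Type} [Finite Γ] [Finite S] : Finite (Op Γ S) := by
  let f : Op Γ S → (Γ ⊕ Γ) ⊕ (S × Γ) ⊕ Bool := fun o => match o with
    | .left x => .inl (.inl x)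
    | .right x => .inl (.inr x)
    | .state q x => .inr (.inl (q, x))
    | .fst => .inr (.inr true)
    | .snd => .inr (.inr false)
  refine Finite.of_injective f fun a b h => ?_
  cases a <;> cases b <;> simp [f] at h <;> simp [h]

open TM0 Op

/-- The identities `g (f x) = g' (f' x)` that describe the machine `M`. -/
inductive Identity (M : Machine Γ Λ) (S : Set Λ) : Op Γ S → Op Γ S → Op Γ S → Op Γ S → Prop
  | comm (x y : Γ) : Identity M S (left x) (right y) (right y) (left x)
  | write (q q' : S) (x y z : Γ) : M q x = some (↑q', Stmt.write y) →
      Identity M S (left z) (state q x) (left z) (state q' y)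
  | moveLeft (q q' : S) (x z : Γ) : M q x = some (↑q', Stmt.move Dir.left) →
      Identity M S (left z) (state q x) (right x) (state q' z)
  | moveRight (q q' : S) (x z : Γ) : M q x = some (↑q', Stmt.move Dir.right) →
      Identity M S (right z) (state q x) (left x) (state q' z)
  | halt (q : S) (x : Γ) : M q x = none → Identity M S (state q x) fst (state q x) snd
  | symm {f g f' g'} : Identity M S f g f' g' → Identity M S f' g' f g

open Classical in
/-- The standard interpretation: half-tapes, and truth values for halting. -/
noncomputable def opFn (M : Machine Γ Λ) {S : Set Λ} :
    Op Γ S → (ListBlank Γ × ListBlank Γ) ⊕ Bool → (ListBlank Γ × ListBlank Γ) ⊕ Bool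
  | left x, Sum.inl t => Sum.inl (t.1.cons x, t.2)
  | right x, Sum.inl t => Sum.inl (t.1, t.2.cons x)
  | state q x, Sum.inl t => Sum.inr (decide (Halts M ⟨q, ⟨x, t.1, t.2⟩⟩))
  | fst, Sum.inr false => Sum.inr false
  | _, _ => Sum.inr true

theorem opFn_identity {M : Machine Γ Λ} {S : Set Λ} {f g f' g' : Op Γ S}
    (h : Identity M S f g f' g') (d : (ListBlank Γ × ListBlank Γ) ⊕ Bool) :
    opFn M g (opFn M f d) = opFn M g' (opFn M f' d) := by
  induction h with
  | symm _ ih => exact ih.symm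
  | comm => cases d <;> rfl
  | write q q' x y z h =>
    rcases d with ⟨l, r⟩ | d
    · simp only [opFn]
      rw [halts_iff_of_mem_step (M := M) (c' := ⟨q', ⟨y, l.cons z, r⟩⟩)]
      simp [TM0.step, h, Tape.write]
    · rfl
  | moveLeft q q' x z h =>
    rcases d with ⟨l, r⟩ | d
    · simp only [opFn]
      rw [halts_iff_of_mem_step (M := M) (c' := ⟨q', ⟨z, l, r.cons x⟩⟩)]
      simp [TM0.step, h, Tape.move]
    · rfl
  | moveRight q q' x z h =>
    rcases d with ⟨l, r⟩ | d
    · simp only [opFn]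
      rw [halts_iff_of_mem_step (M := M) (c' := ⟨q', ⟨z, l.cons x, r⟩⟩)]
      simp [TM0.step, h, Tape.move]
    · rfl
  | halt q x h =>
    rcases d with ⟨l, r⟩ | d
    · simp only [opFn]
      have hh : Halts M ⟨q, ⟨x, l, r⟩⟩ := halts_of_step_eq_none (by simp [TM0.step, h])
      simp only [hh, decide_true]
    · rfl

/-- The values of operations that describe the input consisting of the symbol `c` followed by `m`
symbols `b`, with the symbol `a` being scanned in the state `q`. -/
def opEdges {S : Type} (q : S) (a b c : Γ) (m : ℕ) : List (ℕ × Op Γ S × ℕ) :=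
  [(1, fst, 1), (1, snd, 0), (2, state q a, 1), (3, left default, 3), (3, right default, 3),
    (m + 3, right c, 2)] ++ (List.range m).map fun i => (i + 3, right b, i + 4)

theorem opEdges_functional {S : Type} {q : S} {a b c : Γ} (hb : b ≠ default) (hc : c ≠ default)
    (hcb : c ≠ b) {m i : ℕ} {f : Op Γ S} {j j' : ℕ} (h : (i, f, j) ∈ opEdges q a b c m)
    (h' : (i, f, j') ∈ opEdges q a b c m) : j = j' := by
  simp only [opEdges, List.mem_append, List.mem_cons, List.not_mem_nil, or_false,
    List.mem_map, List.mem_range, Prod.mk.injEq] at h h'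
  rcases h with (⟨rfl, rfl, rfl⟩ | ⟨rfl, rfl, rfl⟩ | ⟨rfl, rfl, rfl⟩ | ⟨rfl, rfl, rfl⟩ |
    ⟨rfl, rfl, rfl⟩ | ⟨rfl, rfl, rfl⟩) | ⟨i, hi, rfl, rfl, rfl⟩ <;>
  simp [hb, hc, hcb.symm, hc.symm] at h' <;> omega

theorem solvable_standard {M : Machine Γ Λ} {S : Set Λ} {q : S} {a b c : Γ} (hb : b ≠ default)
    (hcb : c ≠ b) (hc : c ≠ default) {m : ℕ}
    (h : ¬ Halts M ⟨q, ⟨a, ∅, ListBlank.mk (c :: List.replicate m b)⟩⟩) :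
    ∃ (ν : ℕ → (ListBlank Γ × ListBlank Γ) ⊕ Bool), Function.Injective ν ∧
      ∀ e ∈ opEdges q a b c m, opFn M e.2.1 (ν e.1) = ν e.2.2 := by
  let top : ListBlank Γ := ListBlank.mk (c :: List.replicate m b)
  let T : ℕ → ListBlank Γ := fun n => ListBlank.mk (List.replicate n b)
  have hT0 : T 0 = ∅ := rfl
  have hTs : ∀ n, (T n).cons b = T (n + 1) := fun n => by
    simp only [T, ListBlank.cons_mk, List.replicate_succ]
  have hnth : ∀ n i, (T n).nth i = if i < n then b else default := by
    intro n i
    simp only [T, ListBlank.nth_mk, List.getI_eq_getElem?_getD]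
    split_ifs with h
    · simp [h]
    · rw [List.getElem?_eq_none (by simpa using h)]; rfl
  have hT : ∀ i j, i < j → T i ≠ T j := by
    intro i j hij h
    have := hnth i i
    rw [h, hnth] at this
    simp [hij, hb] at this
  have htop : ∀ n, top ≠ T n := by
    intro n h
    have h1 : top.head = c := rfl
    rw [h, ← ListBlank.nth_zero, hnth] at h1
    split_ifs at h1
    · exact hcb h1.symm
    · exact hc h1.symm
  let ν : ℕ → (ListBlank Γ × ListBlank Γ) ⊕ Bool := fun n => match n with
    | 0 => Sum.inr true
    | 1 => Sum.inr false
    | 2 => Sum.inl (∅, top)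
    | n + 3 => Sum.inl (∅, T n)
  refine ⟨ν, ?_, ?_⟩
  · have hlt : ∀ i j, i < j → ν i ≠ ν j := by
      intro i j hij
      match i, j with
      | 0, 0 => omega
      | 0, 1 => simp [ν]
      | 0, 2 => simp [ν]
      | 0, j + 3 => simp [ν]
      | 1, 2 => simp [ν]
      | 1, j + 3 => simp [ν]
      | 2, j + 3 => simpa [ν] using htop j
      | i + 3, j + 3 => simpa [ν] using hT i j (by omega)
    intro i j h
    rcases lt_trichotomy i j with hij | hij | hij
    · exact (hlt _ _ hij h).elim
    · exact hij
    · exact (hlt _ _ hij h.symm).elim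
  · intro e he
    simp only [opEdges, List.mem_append, List.mem_cons, List.not_mem_nil, or_false,
      List.mem_map, List.mem_range] at he
    have hblank : (∅ : ListBlank Γ).cons default = ∅ := ListBlank.cons_head_tail ∅
    rcases he with (rfl | rfl | rfl | rfl | rfl | rfl) | ⟨i, hi, rfl⟩
    · rfl
    · rfl
    · simp only [ν, opFn, top, h, decide_false]
    · simp only [ν, opFn, hT0, hblank]
    · simp only [ν, opFn, hT0, hblank]
    · simp only [ν, opFn, T, top, ListBlank.cons_mk]
    · simp only [ν, opFn, hTs]

section Derivation

variable {M : Machine Γ Λ} {S : Set Λ} {D : Type} {fn : Op Γ S → D → D}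

/-- The value of the tape with the given halves, where `e` is the value of the empty tape. -/
def tapeVal (fn : Op Γ S → D → D) (e : D) (l r : List Γ) : D :=
  l.foldr (fun x => fn (left x)) (r.foldr (fun x => fn (right x)) e)

variable (hfn : ∀ f g f' g', Identity M S f g f' g' → ∀ d, fn g (fn f d) = fn g' (fn f' d))
  {e : D} (hl : fn (left default) e = e) (hr : fn (right default) e = e)
include hfn

omit [Inhabited Γ] in
theorem right_tapeVal (x : Γ) (l r : List Γ) :
    fn (right x) (tapeVal fn e l r) = tapeVal fn e l (x :: r) := by
  induction l with
  | nil => rfl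
  | cons y l ih =>
    change fn (right x) (fn (left y) (tapeVal fn e l r)) = fn (left y) (tapeVal fn e l (x :: r))
    rw [hfn _ _ _ _ (.comm y x), ih]

include hr in
theorem right_head_tapeVal (l r : List Γ) :
    fn (right r.headI) (tapeVal fn e l r.tail) = tapeVal fn e l r := by
  cases r with
  | cons y r => exact right_tapeVal hfn y l r
  | nil =>
    induction l with
    | nil => exact hr
    | cons y l ih =>
      change fn (right _) (fn (left y) (tapeVal fn e l [])) = fn (left y) (tapeVal fn e l [])
      rw [hfn _ _ _ _ (.comm y _)]
      exact congrArg _ ih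

include hl in
theorem left_head_tapeVal (l r : List Γ) :
    fn (left l.headI) (tapeVal fn e l.tail r) = tapeVal fn e l r := by
  cases l with
  | cons y l => rfl
  | nil =>
    induction r with
    | nil => exact hl
    | cons y r ih =>
      change fn (left _) (fn (right y) (tapeVal fn e [] r)) = fn (right y) (tapeVal fn e [] r)
      rw [← hfn _ _ _ _ (.comm _ y)]
      exact congrArg _ ih

include hl hr in
theorem fst_eq_snd_of_halts (hS : Supports M S) {c : Cfg Γ Λ} (hc : Halts M c) :
    ∀ (q : S) (x : Γ) (l r : List Γ), c = ⟨q, ⟨x, ListBlank.mk l, ListBlank.mk r⟩⟩ →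
      fn fst (fn (state q x) (tapeVal fn e l r)) = fn snd (fn (state q x) (tapeVal fn e l r)) := by
  obtain ⟨c', hc'⟩ := Part.dom_iff_mem.1 hc
  obtain ⟨hreach, hnone⟩ := StateTransition.mem_eval.1 hc'
  clear hc hc'
  induction hreach using Relation.ReflTransGen.head_induction_on with
  | refl =>
    rintro q x l r rfl
    refine hfn _ _ _ _ (.halt q x ?_) _
    simpa [TM0.step] using hnone
  | @head c c₁ h _ ih =>
    rintro q x l r rfl
    obtain ⟨⟨q', s⟩, hM, hs⟩ := Option.map_eq_some_iff.1 h
    have hq' : q' ∈ S := hS.2 hM q.2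
    subst hs
    match s with
    | Stmt.write y =>
      have key := hfn _ _ _ _ (.write q ⟨q', hq'⟩ x y l.headI hM) (tapeVal fn e l.tail r)
      rw [left_head_tapeVal hfn hl] at key
      rw [key]
      exact ih ⟨q', hq'⟩ y l r rfl
    | Stmt.move Dir.left =>
      have key := hfn _ _ _ _ (.moveLeft q ⟨q', hq'⟩ x l.headI hM) (tapeVal fn e l.tail r)
      rw [left_head_tapeVal hfn hl, right_tapeVal hfn] at key
      rw [key]
      exact ih ⟨q', hq'⟩ _ _ _ (by simp [Tape.move])
    | Stmt.move Dir.right =>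
      have key := hfn _ _ _ _ (.moveRight q ⟨q', hq'⟩ x r.headI hM) (tapeVal fn e l r.tail)
      rw [right_head_tapeVal hfn hr] at key
      rw [key]
      exact ih ⟨q', hq'⟩ _ (x :: l) _ (by simp [Tape.move])

theorem not_halts_of_solution (hS : Supports M S) {q : S} {a b c : Γ} {m : ℕ} {ν : ℕ → D}
    (hν : Function.Injective ν)
    (hedge : ∀ e ∈ opEdges q a b c m, fn e.2.1 (ν e.1) = ν e.2.2) :
    ¬ Halts M ⟨q, ⟨a, ∅, ListBlank.mk (c :: List.replicate m b)⟩⟩ := by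
  intro h
  have hE : ∀ i f j, (i, f, j) ∈ opEdges q a b c m → fn f (ν i) = ν j :=
    fun i f j h => hedge _ h
  have hpath : ∀ i ≤ m, tapeVal fn (ν 3) [] (List.replicate i b) = ν (i + 3) := by
    intro i hi
    induction i with
    | zero => rfl
    | succ i ih =>
      change fn (right b) (tapeVal fn (ν 3) [] (List.replicate i b)) = _
      rw [ih (by omega)]
      exact hE _ _ _ (List.mem_append_right _ (List.mem_map.2 ⟨i, List.mem_range.2 hi, rfl⟩))
  have htop : tapeVal fn (ν 3) [] (c :: List.replicate m b) = ν 2 := by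
    change fn (right c) (tapeVal fn (ν 3) [] (List.replicate m b)) = _
    rw [hpath m le_rfl]
    exact hE _ _ _ (by simp [opEdges])
  have := fst_eq_snd_of_halts hfn (hE 3 (left default) 3 (by simp [opEdges]))
    (hE 3 (right default) 3 (by simp [opEdges])) hS h q a [] (c :: List.replicate m b) rfl
  rw [htop, hE 2 (state q a) 1 (by simp [opEdges]), hE 1 fst 1 (by simp [opEdges]),
    hE 1 snd 0 (by simp [opEdges])] at this
  exact absurd (hν this) (by simp)

end Derivation

end Encoding

end OrderQA

namespace OrderQA

open Turing

instance (k : ℕ) : Primcodable (RelAtom (algSig k) ℕ) :=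
  RelAtom.instPrimcodable (algSig k)

theorem primrec_algFacts {k : ℕ} (rules : List (Fin k × Fin k × Fin k × Fin k)) :
    Primrec (algFacts rules) := by
  have hfst : Primrec fun e : ℕ × Fin k × ℕ => k + e.1 :=
    Primrec.nat_add.comp (Primrec.const k) Primrec.fst
  have hsnd : Primrec fun e : ℕ × Fin k × ℕ => k + e.2.2 :=
    Primrec.nat_add.comp (Primrec.const k) (Primrec.snd.comp Primrec.snd)
  have hop : Primrec fun e : ℕ × Fin k × ℕ => (e.2.1 : ℕ) :=
    Primrec.fin_val.comp (Primrec.fst.comp Primrec.snd)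
  have hnode : ∀ f : ℕ × Fin k × ℕ → ℕ, Primrec f →
      Primrec fun e => nodeAtom (f e) (List.range k) List.length_range := fun f hf =>
    Primrec.subtype_mk (hp := RelAtom.primrecPred_wellFormed (algSig k))
      (Primrec.pair (Primrec.const (nodeRel k))
        (Primrec.list_cons.comp hf (Primrec.const (List.range k))))
  have hedge : Primrec fun e : ℕ × Fin k × ℕ =>
      (edgeAtom (k + e.1) e.2.1 (k + e.2.2) : RelAtom (algSig k) ℕ) :=
    Primrec.subtype_mk (hp := RelAtom.primrecPred_wellFormed (algSig k))
      (Primrec.pair (Primrec.const (edgeRel k))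
        (Primrec.list_cons.comp hfst (Primrec.list_cons.comp hop
          (Primrec.list_cons.comp hsnd (Primrec.const [])))))
  refine Primrec.list_append.comp (Primrec.const _) (Primrec.list_flatMap Primrec.id ?_)
  exact (Primrec.list_cons.comp (hnode _ hfst) (Primrec.list_cons.comp (hnode _ hsnd)
    (Primrec.list_cons.comp hedge (Primrec.const [])))).comp Primrec.snd

section

variable {Γ Λ : Type} [Inhabited Γ] [Inhabited Λ] {k : ℕ}

/-- The prescribed values of operations, with the operations numbered by `num`. -/
def codedEdges {S : Type} (num : Op Γ S ≃ Fin k) (q : S) (a b c : Γ) (m : ℕ) :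
    List (ℕ × Fin k × ℕ) :=
  (opEdges q a b c m).map fun e => (e.1, num e.2.1, e.2.2)

theorem primrec_codedEdges {S : Type} (num : Op Γ S ≃ Fin k) (q : S) (a b c : Γ) :
    Primrec (codedEdges num q a b c) := by
  have : codedEdges num q a b c = fun m =>
      [(1, num .fst, 1), (1, num .snd, 0), (2, num (.state q a), 1),
        (3, num (.left default), 3), (3, num (.right default), 3)] ++
      ([(m + 3, num (.right c), 2)] ++
        (List.range m).map fun i => (i + 3, num (.right b), i + 4)) := by
    funext m
    simp [codedEdges, opEdges]
  rw [this]
  have hadd : ∀ n : ℕ, Primrec fun m : ℕ => m + n := fun n =>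
    Primrec.nat_add.comp Primrec.id (Primrec.const n)
  refine Primrec.list_append.comp (Primrec.const _) (Primrec.list_append.comp ?_ ?_)
  · exact Primrec.list_cons.comp (Primrec.pair (hadd 3) (Primrec.const _)) (Primrec.const [])
  · exact Primrec.list_map Primrec.list_range
      ((Primrec.pair (hadd 3) (Primrec.pair (Primrec.const _) (hadd 4))).comp Primrec.snd)

theorem solvable_iff_not_halts {M : TM0.Machine Γ Λ} {S : Set Λ} (hS : TM0.Supports M S)
    (num : Op Γ S ≃ Fin k) {rules : List (Fin k × Fin k × Fin k × Fin k)}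
    (hrules : ∀ f g f' g', (f, g, f', g') ∈ rules ↔
      Identity M S (num.symm f) (num.symm g) (num.symm f') (num.symm g'))
    {q : S} {a b c : Γ} (hb : b ≠ default) (hc : c ≠ default) (hcb : c ≠ b) {m : ℕ} :
    Solvable rules (codedEdges num q a b c m) ↔
      ¬ Halts M ⟨q, ⟨a, ∅, ListBlank.mk (c :: List.replicate m b)⟩⟩ := by
  constructor
  · rintro ⟨D, fn, ν, hν, hr, he⟩
    refine not_halts_of_solution (fn := fun o => fn (num o)) (fun f g f' g' h d => ?_) hS hν
      fun e h => he (e.1, num e.2.1, e.2.2) (List.mem_map.2 ⟨e, h, rfl⟩)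
    exact hr (num f, num g, num f', num g') ((hrules _ _ _ _).2 (by simpa using h)) d
  · intro h
    obtain ⟨ν, hν, he⟩ := solvable_standard hb hcb hc h
    refine ⟨_, fun i => opFn M (num.symm i), ν, hν, ?_, ?_⟩
    · rintro ⟨f, g, f', g'⟩ hr x
      exact opFn_identity ((hrules _ _ _ _).1 hr) x
    · intro e h
      obtain ⟨e, hm, rfl⟩ := List.mem_map.1 h
      simpa using he e hm

end

/-- There are a finite set of operations and finitely many identities for which it is undecidable
whether the entailment for given values of operations holds. -/
theorem exists_undecidable_entailsLin :
    ∃ k, ¬ ComputablePred fun F₀ : List (RelAtom (algSig k) ℕ) =>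
      EntailsLin {f | f ∈ F₀} (algDeps k) [algQuery k] := by
  obtain ⟨Γ, Λ, _, _, _, M, S, a, b, c, hfin, hS, hb, hc, hcb, hM⟩ := exists_machine
  have : Finite S := hfin
  obtain ⟨k, ⟨num⟩⟩ := Finite.exists_equiv_fin (Op Γ S)
  have hk : 0 < k := Fin.pos (num .fst)
  let q₀ : S := ⟨default, hS.1⟩
  obtain ⟨rules, hrules⟩ : ∃ rules : List (Fin k × Fin k × Fin k × Fin k), ∀ f g f' g',
      (f, g, f', g') ∈ rules ↔
        Identity M S (num.symm f) (num.symm g) (num.symm f') (num.symm g') := by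
    refine ⟨(Set.toFinite {r : Fin k × Fin k × Fin k × Fin k | Identity M S (num.symm r.1)
      (num.symm r.2.1) (num.symm r.2.2.1) (num.symm r.2.2.2)}).toFinset.toList, ?_⟩
    intro f g f' g'
    rw [Finset.mem_toList, Set.Finite.mem_toFinset]
    rfl
  refine ⟨k, fun h => hM ?_⟩
  refine ComputablePred.computable_of_manyOneReducible
    ⟨fun m => algFacts rules (codedEdges num q₀ a b c m),
      ((primrec_algFacts rules).comp (primrec_codedEdges num q₀ a b c)).to_comp, fun m => ?_⟩ h
  have hsymm : ∀ f g f' g', (f, g, f', g') ∈ rules → (f', g', f, g) ∈ rules := by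
    intro f g f' g' hr
    exact (hrules _ _ _ _).2 ((hrules _ _ _ _).1 hr).symm
  have hfun : ∀ i f j j', (i, f, j) ∈ codedEdges num q₀ a b c m →
      (i, f, j') ∈ codedEdges num q₀ a b c m → j = j' := by
    intro i f j j' h h'
    obtain ⟨⟨_, f, _⟩, hm, he⟩ := List.mem_map.1 h
    obtain ⟨⟨_, f', _⟩, hm', he'⟩ := List.mem_map.1 h'
    simp only [Prod.mk.injEq] at he he'
    obtain ⟨rfl, rfl, rfl⟩ := he
    obtain ⟨rfl, hf, rfl⟩ := he'
    obtain rfl := num.injective hf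
    exact opEdges_functional hb hc hcb hm hm'
  exact not_iff_not.1 ((solvable_iff_not_halts hS num hrules hb hc hcb).symm.trans
    (not_entailsLin_iff_solvable hk hsymm hfun).symm)

end OrderQA

theorem mainTheorem12 :
    (∃ (σ : OrderQA.Signature) (T : List (OrderQA.TGD σ)) (Q : OrderQA.CQ σ),
      σ.numDist = 1 ∧
      (∀ τ ∈ T, τ.IsID ∧ τ.OnBase) ∧
      ¬ Q.BaseCovered ∧
      ¬ ComputablePred (fun F₀ : List (OrderQA.RelAtom σ ℕ) =>
          OrderQA.EntailsLin {f | f ∈ F₀} T [Q])) ∧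
    (∃ (σ : OrderQA.Signature) (T : List (OrderQA.TGD σ)),
      σ.numDist = 1 ∧
      (∀ τ ∈ T, τ.IsBaseFGTGD) ∧
      ¬ ComputablePred (fun F₀ : List (OrderQA.RelAtom σ ℕ) =>
          OrderQA.EntailsLin {f | f ∈ F₀} T [])) := by
  obtain ⟨k, hk⟩ := OrderQA.exists_undecidable_entailsLin
  refine ⟨⟨OrderQA.algSig k, OrderQA.algDeps k, OrderQA.algQuery k, rfl,
    OrderQA.isID_of_mem_algDeps, OrderQA.not_baseCovered_algQuery, hk⟩,
    ⟨OrderQA.algSig k, OrderQA.algDenial k :: OrderQA.algDeps k, rfl, ?_, ?_⟩⟩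
  · intro τ hτ
    rcases List.mem_cons.1 hτ with rfl | hτ
    · exact OrderQA.isBaseFGTGD_algDenial
    · exact OrderQA.isBaseFGTGD_of_isID (OrderQA.isID_of_mem_algDeps τ hτ).1
        (OrderQA.isID_of_mem_algDeps τ hτ).2
  · simpa only [OrderQA.entailsLin_algDenial_iff] using hk
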